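/- Let $T$ be a standard Young tableau with $n$ boxes (each of $1,\dots,n$ appears exactly once, rows increase from left to right and columns increase from top to bottom); for $1\le j\le n$ let $r_j(T)$ be the row containing $j$ and let $T_{<j}$ be the subtableau occupied by the entries $1,\dots,j-1$. Call $T$ a Richardson tableau if for every $j$ with $r_j(T)\ge 2$ the largest entry of $T_{<j}$ in row $r_j(T)-1$ is greater than every entry of $T_{<j}$ lying in or below row $r_j(T)$. The evacuation tableau $\mathrm{evac}(T)$ is defined as follows. Remove the entry $1$ from the upper left corner of $T$ and decrease all other entries by $1$. Slide the resulting empty box: among the boxes directly below and directly to the right of it, locate the one with the smaller entry and swap it with the empty box, and repeat until there is no box directly below or directly to the right. This leaves a standard tableau $\Delta(T)$ with $n-1$ boxes; put $n$ into the box of $\mathrm{evac}(T)$ at the final position of the empty box. Repeat with $\Delta(T)$ to place $n-1$, and so on down to $1$. The set of Richardson tableaux is closed under evacuation: if $T$ is a Richardson tableau, then $\mathrm{evac}(T)$ is a standard Young tableau of the same shape as $T$ and is a Richardson tableau. -/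

import Mathlib

namespace SemistandardYoungTableau

/-- `T` is standard: each of `1, …, n` (`n` the number of boxes) appears in exactly one box. -/
def IsStandard {μ : YoungDiagram} (T : SemistandardYoungTableau μ) : Prop :=
  Set.BijOn (fun c : ℕ × ℕ => T c.1 c.2) (μ.cells : Set (ℕ × ℕ)) (Set.Icc 1 μ.card)

/-- The Richardson condition. Rows are numbered from `0`, so the boxes lying in the second row or
below are the boxes `(i + 1, c)`; with `j` the entry of such a box, the largest entry smaller
than `j` in the row directly above is greater than every entry smaller than `j` that lies in or
below the row of `j`. -/
def RichardsonCondition {μ : YoungDiagram} (T : SemistandardYoungTableau μ) : Prop :=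
  ∀ i c j : ℕ, (i + 1, c) ∈ μ → T (i + 1) c = j →
    ∃ m : ℕ, IsGreatest {x | x < j ∧ ∃ b, (i, b) ∈ μ ∧ T i b = x} m ∧
      ∀ a b : ℕ, (a, b) ∈ μ → i + 1 ≤ a → T a b < j → T a b < m

/-- A Richardson tableau is a standard tableau which satisfies the Richardson condition. -/
def IsRichardson {μ : YoungDiagram} (T : SemistandardYoungTableau μ) : Prop :=
  T.IsStandard ∧ T.RichardsonCondition

/-- Slide the empty box `c` through the filling `F`, where the value `0` means that there is no
entry: as long as the box directly below or directly to the right holds an entry, swap the empty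
box with the one of these that holds the smaller entry. Returns the new filling and the final
position of the empty box. The first argument bounds the number of swaps; every swap moves the
empty box to a new box of the diagram, so the number of boxes is never exceeded. -/
def slide : ℕ → ℕ × ℕ → (ℕ × ℕ → ℕ) → (ℕ × ℕ → ℕ) × (ℕ × ℕ)
  | 0, c, F => (F, c)
  | k + 1, c, F =>
    let below := (c.1 + 1, c.2)
    let right := (c.1, c.2 + 1)
    if F below = 0 ∧ F right = 0 then (F, c)
    else if F right = 0 ∨ (F below ≠ 0 ∧ F below < F right) then
      slide k below (F ∘ Equiv.swap c below)
    else
      slide k right (F ∘ Equiv.swap c right)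

/-- The rounds of evacuation: `F` is the current filling, a standard tableau with `k` boxes, and
`G` is the part of the evacuation tableau found so far. Subtracting `1` from every entry removes
the entry `1` in the upper left corner (the box becomes empty) and decreases the other entries;
the box where the empty box stops receives the number `k` in the evacuation tableau. -/
def evacRounds : ℕ → (ℕ × ℕ → ℕ) → (ℕ × ℕ → ℕ) → (ℕ × ℕ → ℕ)
  | 0, _, G => G
  | k + 1, F, G =>
    let s := slide (k + 1) (0, 0) (fun c => F c - 1)
    evacRounds k s.1 (Function.update G s.2 (k + 1))

/-- The filling `evac T`, with value `0` outside the diagram. -/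
def evac {μ : YoungDiagram} (T : SemistandardYoungTableau μ) : ℕ → ℕ → ℕ :=
  fun i j => evacRounds μ.card (fun c => T c.1 c.2) (fun _ => 0) (i, j)

end SemistandardYoungTableau

namespace SemistandardYoungTableau

/-! The Richardson condition makes every slide hook-shaped: it descends the first column to the
first row `k` where it must turn, and from there never leaves row `k` (`right_lt_below`). Entries
only move up the first column or left along row `k`, so the result can be described explicitly, and
it is again Richardson (`slideResult_rich`).

The evacuation is then built by induction: evacuate the filling after the slide, then put the
largest entry at the end of row `k`. Only the condition at that new box needs an argument: row `k -
1` must already contain the maximum of all rows from `k - 1` down. This is the invariant carried by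
`exists_evacRounds_eq`: a row at which the slide would turn has this property in the evacuation. It
applies because, after the slide, column strictness of the old second column prevents the next slide
from descending out of row `k - 1`. -/

/-- A filling of boxes (`0` meaning "no entry") with the entries `1, …, n`, each used once, whose
nonempty boxes are left-justified with increasing rows, and which satisfies the Richardson
condition. -/
structure IsRichardsonFilling (n : ℕ) (F : ℕ × ℕ → ℕ) : Prop where
  row : ∀ i c, F (i, c + 1) ≠ 0 → F (i, c) ≠ 0 ∧ F (i, c) < F (i, c + 1)
  rich : ∀ i c, F (i + 1, c) ≠ 0 → ∃ b, F (i, b) ≠ 0 ∧ F (i, b) < F (i + 1, c) ∧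
    ∀ a d, i < a → F (a, d) < F (i + 1, c) → F (a, d) < F (i, b)
  inj : ∀ x y, F x = F y → F x ≠ 0 → x = y
  surj : ∀ j, j ≠ 0 → j ≤ n → ∃ x, F x = j
  le : ∀ x, F x ≤ n

/-- The slide leaves the box `(i, 0)` downwards. -/
def Descends (F : ℕ × ℕ → ℕ) (i : ℕ) : Prop :=
  F (i + 1, 0) ≠ 0 ∧ (F (i, 1) = 0 ∨ F (i + 1, 0) < F (i, 1))

/-- The filling during a slide which went down the first column to row `i` and then right to
column `c`. -/
def slideState (i c : ℕ) (F : ℕ × ℕ → ℕ) : ℕ × ℕ → ℕ := fun x =>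
  if x.1 < i ∧ x.2 = 0 then F (x.1 + 1, 0) - 1
  else if x.1 = i ∧ x.2 < c then F (i, x.2 + 1) - 1
  else if x.1 = i ∧ x.2 = c then 0
  else F x - 1

/-- The filling after a slide down the first column to row `k` and then right to the end. -/
def slideResult (k : ℕ) (F : ℕ × ℕ → ℕ) : ℕ × ℕ → ℕ := fun x =>
  if x.1 < k ∧ x.2 = 0 then F (x.1 + 1, 0) - 1
  else if x.1 = k then F (k, x.2 + 1) - 1
  else F x - 1

theorem slideState_right (i c : ℕ) (F : ℕ × ℕ → ℕ) :
    slideState i c F ∘ Equiv.swap (i, c) (i, c + 1) = slideState i (c + 1) F := by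
  funext ⟨a, d⟩
  rw [Function.comp]
  by_cases h1 : (a, d) = (i, c)
  · rw [h1, Equiv.swap_apply_left]
    simp [slideState]
  · by_cases h2 : (a, d) = (i, c + 1)
    · rw [h2, Equiv.swap_apply_right]
      simp [slideState]
    · rw [Equiv.swap_apply_of_ne_of_ne h1 h2]
      simp only [Prod.mk.injEq] at h1 h2
      simp only [slideState]
      split_ifs <;> first | rfl | omega

theorem slideState_down (i : ℕ) (F : ℕ × ℕ → ℕ) :
    slideState i 0 F ∘ Equiv.swap (i, 0) (i + 1, 0) = slideState (i + 1) 0 F := by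
  funext ⟨a, d⟩
  rw [Function.comp]
  by_cases h1 : (a, d) = (i, 0)
  · rw [h1, Equiv.swap_apply_left]
    simp [slideState]
  · by_cases h2 : (a, d) = (i + 1, 0)
    · rw [h2, Equiv.swap_apply_right]
      simp [slideState]
    · rw [Equiv.swap_apply_of_ne_of_ne h1 h2]
      simp only [Prod.mk.injEq] at h1 h2
      simp only [slideState]
      split_ifs <;> first | rfl | omega

/-! ### Order properties and the path of a slide -/

namespace IsRichardsonFilling

variable {n : ℕ} {F : ℕ × ℕ → ℕ}

theorem row_le (h : IsRichardsonFilling n F) {i c d : ℕ} (hcd : c ≤ d) (hd : F (i, d) ≠ 0) :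
    F (i, c) ≠ 0 ∧ F (i, c) ≤ F (i, d) := by
  induction d, hcd using Nat.le_induction with
  | base => exact ⟨hd, le_rfl⟩
  | succ d _ ih =>
    have h1 := h.row i d hd
    have h2 := ih h1.1
    exact ⟨h2.1, by omega⟩

theorem lt_of_row_lt (h : IsRichardsonFilling n F) {i c d : ℕ} (hc : F (i, c) ≠ 0)
    (hlt : F (i, c) < F (i, d)) : c < d := by
  by_contra hn
  have := h.row_le (not_lt.mp hn) hc
  omega

/-- Column strictness is not a field because it follows from `rich`: the witness for `(i + 1, c +
1)` exceeds the entry at `(i + 1, c)`, hence by induction the one at `(i, c)`, so it lies in column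
`c + 1` or further right. -/
theorem col (h : IsRichardsonFilling n F) {i c : ℕ} (hc : F (i + 1, c) ≠ 0) :
    F (i, c) ≠ 0 ∧ F (i, c) < F (i + 1, c) := by
  induction c with
  | zero =>
    obtain ⟨b, hb, hlt, -⟩ := h.rich i 0 hc
    have := h.row_le (Nat.zero_le b) hb
    exact ⟨this.1, by omega⟩
  | succ c ih =>
    obtain ⟨b, hb, hlt, hm⟩ := h.rich i (c + 1) hc
    have h1 := h.row (i + 1) c hc
    have h2 := ih h1.1
    have h3 := hm (i + 1) c (by omega) h1.2
    have h4 := h.lt_of_row_lt h2.1 (h2.2.trans h3)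
    have := h.row_le (Nat.succ_le_of_lt h4) hb
    exact ⟨this.1, this.2.trans_lt hlt⟩

theorem corner_le (h : IsRichardsonFilling n F) {i a d : ℕ} (hia : i ≤ a) (hd : F (a, d) ≠ 0) :
    F (i, 0) ≠ 0 ∧ F (i, 0) ≤ F (a, d) := by
  have h0 := h.row_le (Nat.zero_le d) hd
  suffices F (i, 0) ≠ 0 ∧ F (i, 0) ≤ F (a, 0) from ⟨this.1, this.2.trans h0.2⟩
  replace h0 := h0.1
  induction a, hia using Nat.le_induction generalizing d with
  | base => exact ⟨h0, le_rfl⟩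
  | succ a _ ih =>
    have h1 := h.col h0
    have h2 := ih h1.1 h1.1
    exact ⟨h2.1, by omega⟩

theorem eq_corner (h : IsRichardsonFilling n F) {x : ℕ × ℕ} (hx : F x = 1) : x = (0, 0) := by
  have h1 := h.corner_le (i := 0) (Nat.zero_le x.1) (d := x.2) (by simp [hx])
  exact (h.inj _ _ (by simp only [Prod.mk.eta, hx] at h1 ⊢; omega) h1.1).symm

theorem corner_eq_one (h : IsRichardsonFilling (n + 1) F) : F (0, 0) = 1 := by
  obtain ⟨x, hx⟩ := h.surj 1 one_ne_zero (by omega)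
  exact h.eq_corner hx ▸ hx

/-- Along a row which the slide does not leave at its first box, the entry to the right is always
smaller than the one below. -/
theorem right_lt_below (h : IsRichardsonFilling n F) {i : ℕ} (hi : ¬ Descends F i) {c : ℕ}
    (hc : F (i + 1, c) ≠ 0) : F (i, c + 1) ≠ 0 ∧ F (i, c + 1) < F (i + 1, c) := by
  induction c with
  | zero =>
    simp only [Descends, not_and, not_or, not_lt] at hi
    obtain ⟨h1, h2⟩ := hi hc
    refine ⟨h1, lt_of_le_of_ne h2 fun he => ?_⟩
    have := h.inj _ _ he h1
    simp at this
  | succ c ih =>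
    obtain ⟨b, hb, hlt, hm⟩ := h.rich i (c + 1) hc
    have h1 := h.row (i + 1) c hc
    have h2 := ih h1.1
    have h3 := hm (i + 1) c (by omega) h1.2
    have h4 := h.lt_of_row_lt h2.1 (h2.2.trans h3)
    have := h.row_le (Nat.succ_le_of_lt h4) hb
    exact ⟨this.1, this.2.trans_lt hlt⟩

theorem slide_right (h : IsRichardsonFilling n F) {i : ℕ} (hi : ¬ Descends F i) (m c : ℕ)
    -- The remaining fuel `m` suffices because the original entries along the path strictly increase
    -- and are at most `n`.
    (hc : F (i, c) ≠ 0) (hm : n ≤ m + F (i, c)) :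
    ∃ l, F (i, l) ≠ 0 ∧ F (i, l + 1) = 0 ∧
      slide m (i, c) (slideState i c F) = (slideResult i F, (i, l)) := by
  have row_end : ∀ c, F (i, c + 1) = 0 → slideState i c F = slideResult i F := by
    intro c hc1
    funext ⟨a, d⟩
    have : ∀ e, c ≤ e → F (i, e + 1) = 0 := fun e he => by
      by_contra hne
      exact (h.row_le (Nat.succ_le_succ he) hne).1 hc1
    have h1 := this d
    have h2 := this (d - 1)
    simp only [slideState, slideResult]
    split_ifs <;> grind
  induction m generalizing c with
  | zero =>
    have h1 : F (i, c + 1) = 0 := by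
      by_contra hne
      have := h.row i c hne
      have := h.le (i, c + 1)
      omega
    exact ⟨c, hc, h1, by rw [slide, row_end c h1]⟩
  | succ m ih =>
    have hr : slideState i c F (i, c + 1) = F (i, c + 1) - 1 := by simp [slideState]
    have hb : slideState i c F (i + 1, c) = F (i + 1, c) - 1 := by simp [slideState]
    have h2 := @right_lt_below n F h i hi c
    have h3 := h.row i c
    by_cases h1 : F (i, c + 1) = 0
    · refine ⟨c, hc, h1, ?_⟩
      rw [slide]
      simp only [hr, hb]
      rw [if_pos ⟨by grind, by omega⟩, row_end c h1]
    · obtain ⟨l, hl, hl', hs⟩ := ih (c + 1) h1 (by have := h3 h1; omega)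
      refine ⟨l, hl, hl', ?_⟩
      rw [slide]
      simp only [hr, hb]
      rw [if_neg (by grind), if_neg (by grind), slideState_right, hs]

theorem slide_down (h : IsRichardsonFilling n F) (m i : ℕ)
    (hc : F (i, 0) ≠ 0) (hm : n ≤ m + F (i, 0)) :
    ∃ k l, F (k, l) ≠ 0 ∧ F (k, l + 1) = 0 ∧ ¬ Descends F k ∧
      (∀ a, i ≤ a → a < k → Descends F a) ∧
      slide m (i, 0) (slideState i 0 F) = (slideResult k F, (k, l)) := by
  induction m generalizing i with
  | zero =>
    have hi : ¬ Descends F i := fun hd => by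
      have := h.col hd.1
      have := h.le (i + 1, 0)
      omega
    obtain ⟨l, hl, hl', hs⟩ := h.slide_right hi 0 0 hc hm
    exact ⟨i, l, hl, hl', hi, by omega, hs⟩
  | succ m ih =>
    by_cases hi : Descends F i
    · have h1 := h.col hi.1
      obtain ⟨k, l, hl, hl', hk, ha, hs⟩ := ih (i + 1) hi.1 (by omega)
      refine ⟨k, l, hl, hl', hk, fun a h1 h2 => ?_, ?_⟩
      · rcases h1.eq_or_lt with rfl | h1
        · exact hi
        · exact ha a h1 h2
      · have hr : slideState i 0 F (i, 0 + 1) = F (i, 1) - 1 := by simp [slideState]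
        have hb : slideState i 0 F (i + 1, 0) = F (i + 1, 0) - 1 := by simp [slideState]
        have hd := hi.2
        rw [slide]
        simp only [hr, hb]
        rw [if_neg (by omega), if_pos (by omega), slideState_down, hs]
    · obtain ⟨l, hl, hl', hs⟩ := h.slide_right hi (m + 1) 0 hc hm
      exact ⟨i, l, hl, hl', hi, by omega, hs⟩

/-- The slide in a Richardson tableau goes down the first column and then right. -/
theorem exists_slide_eq (h : IsRichardsonFilling (n + 1) F) :
    ∃ k l, F (k, l) ≠ 0 ∧ F (k, l + 1) = 0 ∧ ¬ Descends F k ∧ (∀ a < k, Descends F a) ∧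
      slide (n + 1) (0, 0) (fun c => F c - 1) = (slideResult k F, (k, l)) := by
  have h1 := h.corner_eq_one
  obtain ⟨k, l, hl, hl', hk, ha, hs⟩ := h.slide_down (n + 1) 0 (by omega) (by omega)
  refine ⟨k, l, hl, hl', hk, fun a => ha a (Nat.zero_le a), ?_⟩
  rw [← hs]
  congr 1
  funext ⟨a, d⟩
  simp only [slideState]
  grind

end IsRichardsonFilling

/-! ### One slide preserves the Richardson condition -/

/-- The box whose entry the slide moves into the box `x`. -/
def slideSource (k : ℕ) (x : ℕ × ℕ) : ℕ × ℕ :=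
  if x.1 < k ∧ x.2 = 0 then (x.1 + 1, 0) else if x.1 = k then (k, x.2 + 1) else x

theorem slideResult_apply (k : ℕ) (F : ℕ × ℕ → ℕ) (x : ℕ × ℕ) :
    slideResult k F x = F (slideSource k x) - 1 := by
  simp only [slideResult, slideSource]
  split_ifs <;> rfl

theorem slideSource_injective (k : ℕ) : Function.Injective (slideSource k) := by
  rintro ⟨a, b⟩ ⟨c, d⟩
  simp only [slideSource]
  grind

theorem slideSource_ne (k : ℕ) (x : ℕ × ℕ) : slideSource k x ≠ (0, 0) := by
  simp only [slideSource]
  grind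

theorem exists_slideSource_eq (k : ℕ) {y : ℕ × ℕ} (hy : y ≠ (0, 0)) :
    ∃ x, slideSource k x = y := by
  obtain ⟨a, d⟩ := y
  by_cases h1 : a ≤ k ∧ d = 0
  · exact ⟨(a - 1, 0), by simp only [slideSource]; grind⟩
  · by_cases h2 : a = k
    · exact ⟨(k, d - 1), by simp only [slideSource]; grind⟩
    · exact ⟨(a, d), by simp only [slideSource]; grind⟩

theorem le_slideSource_fst (k : ℕ) (x : ℕ × ℕ) : x.1 ≤ (slideSource k x).1 := by
  simp only [slideSource]
  grind

namespace IsRichardsonFilling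

variable {n k : ℕ} {F : ℕ × ℕ → ℕ}

theorem apply_slideSource (x : ℕ × ℕ)
    (hx : F (slideSource k x) ≠ 0) : F (slideSource k x) = slideResult k F x + 1 := by
  rw [slideResult_apply]
  omega

/-- Truncated subtraction also sends the entry `1` to `0`, but `1` sits only in the corner, which is
never a source. -/
theorem slideResult_eq_zero (h : IsRichardsonFilling n F) (x : ℕ × ℕ) :
    slideResult k F x = 0 ↔ F (slideSource k x) = 0 := by
  rw [slideResult_apply]
  have : F (slideSource k x) ≠ 1 := fun h1 => slideSource_ne k x (h.eq_corner h1)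
  omega

theorem slideResult_rich (h : IsRichardsonFilling n F) (hk : ¬ Descends F k)
    (ha : ∀ a < k, Descends F a) (i c : ℕ) (hc : slideResult k F (i + 1, c) ≠ 0) :
    ∃ b, slideResult k F (i, b) ≠ 0 ∧ slideResult k F (i, b) < slideResult k F (i + 1, c) ∧
    ∀ a d, i < a → slideResult k F (a, d) < slideResult k F (i + 1, c) →
      slideResult k F (a, d) < slideResult k F (i, b) := by
  have hc' := mt (h.slideResult_eq_zero (k := k) (i + 1, c)).2 hc
  suffices ∃ b, F (slideSource k (i, b)) ≠ 0 ∧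
      F (slideSource k (i, b)) < F (slideSource k (i + 1, c)) ∧
      ∀ a d, i < a → F (slideSource k (a, d)) < F (slideSource k (i + 1, c)) →
        F (slideSource k (a, d)) < F (slideSource k (i, b)) by
    obtain ⟨b, h1, h2, h3⟩ := this
    have h4 := mt (h.slideResult_eq_zero (k := k) (i, b)).1 h1
    refine ⟨b, h4, ?_, fun a d hia hlt => ?_⟩
    · simp only [slideResult_apply] at *
      omega
    · have := h3 a d hia
      simp only [slideResult_apply] at *
      omega
  -- An old witness that stays in row `i` still works, since entries never move down: whatever is
  -- now below row `i` was there before.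
  have key : ∀ b c', slideSource k (i + 1, c) = (i + 1, c') → slideSource k (i, b) = (i, b) ∨
      slideSource k (i, b - 1) = (i, b) → F (i, b) ≠ 0 → F (i, b) < F (i + 1, c') →
      (∀ a d, i < a → F (a, d) < F (i + 1, c') → F (a, d) < F (i, b)) →
      ∃ b, F (slideSource k (i, b)) ≠ 0 ∧
      F (slideSource k (i, b)) < F (slideSource k (i + 1, c)) ∧
      ∀ a d, i < a → F (slideSource k (a, d)) < F (slideSource k (i + 1, c)) →
        F (slideSource k (a, d)) < F (slideSource k (i, b)) := by
    intro b c' h1 h2 h3 h4 h5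
    have : ∃ e, slideSource k (i, e) = (i, b) := by
      rcases h2 with h2 | h2 <;> exact ⟨_, h2⟩
    obtain ⟨e, he⟩ := this
    refine ⟨e, ?_⟩
    rw [he, h1]
    refine ⟨h3, h4, fun a d hia hlt => h5 _ _ (hia.trans_le (le_slideSource_fst k (a, d))) hlt⟩
  rcases lt_trichotomy i k with hik | rfl | hik
  · by_cases hc0 : i + 1 < k ∧ c = 0
    · obtain ⟨hi, rfl⟩ := hc0
      have e1 : slideSource k (i + 1, 0) = (i + 2, 0) := by simp [slideSource, hi]
      have e2 : slideSource k (i, 0) = (i + 1, 0) := by simp [slideSource, hik]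
      rw [e1] at hc' ⊢
      have h1 := h.col hc'
      -- The bound holds because nothing nonempty below row `i` is now smaller than the old entry at
      -- `(i + 2, 0)`: the first entry of row `i + 1` has moved up, and the rest of that row is
      -- larger because the slide descended there.
      refine ⟨0, by rw [e2]; exact h1.1, by rw [e2]; exact h1.2, fun a d hia hlt => ?_⟩
      rw [e2]
      by_cases hz : F (slideSource k (a, d)) = 0
      · rw [hz]; exact Nat.pos_of_ne_zero h1.1
      · exfalso
        by_cases hrow : i + 2 ≤ (slideSource k (a, d)).1
        · have := h.corner_le hrow (d := (slideSource k (a, d)).2) hz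
          simp only [Prod.mk.eta] at this
          omega
        · have hs : a = i + 1 ∧ d ≠ 0 ∧ slideSource k (a, d) = (i + 1, d) := by
            simp only [slideSource] at hrow ⊢
            grind
          obtain ⟨rfl, hd, hs⟩ := hs
          rw [hs] at hz hlt
          have h2 := h.row_le (Nat.one_le_iff_ne_zero.2 hd) hz
          have : F (i + 1, 1) = 0 ∨ F (i + 2, 0) < F (i + 1, 1) := (ha _ hi).2
          omega
    · obtain ⟨c', hs⟩ : ∃ c', slideSource k (i + 1, c) = (i + 1, c' + 1) := by
        by_cases hi : i + 1 = k
        · exact ⟨c, by simp [slideSource, hi]⟩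
        · exact ⟨c - 1, by simp only [slideSource]; grind⟩
      rw [hs] at hc'
      obtain ⟨b, hb, hlt, hm⟩ := h.rich i (c' + 1) hc'
      have h1 := h.row _ _ hc'
      have h2 := h.row_le (Nat.zero_le c') h1.1
      have h3 := h.col h2.1
      -- The first entry of row `i` leaves the row, so the witness must avoid column `0`; it does,
      -- being larger than the entry at `(i + 1, 0)`.
      have h4 := hm _ 0 (Nat.lt_add_one i) (by omega)
      have h5 := h.lt_of_row_lt h3.1 (h3.2.trans h4)
      exact key b _ hs (Or.inl (by simp only [slideSource]; grind)) hb hlt hm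
  · have hs : slideSource i (i + 1, c) = (i + 1, c) := by simp [slideSource]
    rw [hs] at hc'
    obtain ⟨b, hb, hlt, hm⟩ := h.rich i c hc'
    -- The entry at `(i, 0)` leaves the row; if it was the witness, the larger one at `(i, c + 1)`
    -- replaces it.
    rcases Nat.eq_zero_or_pos b with rfl | hb0
    · have h1 := h.right_lt_below hk hc'
      have h2 := h.row_le (Nat.zero_le _) h1.1
      exact key (c + 1) c hs (Or.inr (by simp [slideSource])) h1.1 h1.2
        fun a d hia hl => (hm a d hia hl).trans_le h2.2
    · exact key b c hs (Or.inr (by simp only [slideSource]; grind)) hb hlt hm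
  · have hs : slideSource k (i + 1, c) = (i + 1, c) := by simp only [slideSource]; grind
    rw [hs] at hc'
    obtain ⟨b, hb, hlt, hm⟩ := h.rich i c hc'
    exact key b c hs (Or.inl (by simp only [slideSource]; grind)) hb hlt hm

theorem slideResult_row (h : IsRichardsonFilling n F) (ha : ∀ a < k, Descends F a) (i c : ℕ)
    (hc : slideResult k F (i, c + 1) ≠ 0) :
    slideResult k F (i, c) ≠ 0 ∧ slideResult k F (i, c) < slideResult k F (i, c + 1) := by
  have hc' := mt (h.slideResult_eq_zero (k := k) (i, c + 1)).2 hc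
  suffices F (slideSource k (i, c)) ≠ 0 ∧
      F (slideSource k (i, c)) < F (slideSource k (i, c + 1)) by
    refine ⟨mt (h.slideResult_eq_zero _).1 this.1, ?_⟩
    simp only [slideResult_apply] at *
    omega
  by_cases h0 : i < k ∧ c = 0
  · obtain ⟨hi, rfl⟩ := h0
    have e1 : slideSource k (i, 0) = (i + 1, 0) := by simp [slideSource, hi]
    have e2 : slideSource k (i, 0 + 1) = (i, 1) := by simp [slideSource, hi.ne]
    rw [e2] at hc'
    rw [e1, e2]
    have := ha i hi
    exact ⟨this.1, this.2.resolve_left hc'⟩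
  · by_cases hi : i = k
    · have e1 : ∀ c, slideSource k (i, c) = (i, c + 1) := by simp [slideSource, hi]
      rw [e1] at hc' ⊢
      rw [e1]
      exact h.row _ _ hc'
    · have e1 : slideSource k (i, c) = (i, c) := by simp only [slideSource]; grind
      have e2 : slideSource k (i, c + 1) = (i, c + 1) := by simp [slideSource, hi]
      rw [e2] at hc' ⊢
      rw [e1]
      exact h.row _ _ hc'

theorem slideResult (h : IsRichardsonFilling (n + 1) F) (hk : ¬ Descends F k)
    (ha : ∀ a < k, Descends F a) : IsRichardsonFilling n (slideResult k F) where
  row := h.slideResult_row ha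
  rich := h.slideResult_rich hk ha
  inj x y hxy hx := by
    have h1 := mt (h.slideResult_eq_zero x).2 hx
    have h2 := mt (h.slideResult_eq_zero y).2 (hxy ▸ hx)
    refine slideSource_injective k (h.inj _ _ ?_ h1)
    rw [apply_slideSource x h1, apply_slideSource y h2, hxy]
  surj j hj hjn := by
    obtain ⟨y, hy⟩ := h.surj (j + 1) (by omega) (by omega)
    obtain ⟨x, hx⟩ := exists_slideSource_eq k (y := y) fun h0 => by
      rw [h0, h.corner_eq_one] at hy
      omega
    exact ⟨x, by rw [slideResult_apply, hx, hy]; rfl⟩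
  le x := by
    rw [slideResult_apply]
    have := h.le (slideSource k x)
    omega

/-- The slide empties exactly its final box. -/
theorem slideResult_eq_zero_iff (h : IsRichardsonFilling n F) (ha : ∀ a < k, Descends F a) {l : ℕ}
    (hl : F (k, l) ≠ 0) (hl' : F (k, l + 1) = 0) (x : ℕ × ℕ) :
    SemistandardYoungTableau.slideResult k F x = 0 ↔ F x = 0 ∨ x = (k, l) := by
  rw [h.slideResult_eq_zero]
  obtain ⟨a, d⟩ := x
  by_cases h0 : a < k ∧ d = 0
  · obtain ⟨hi, rfl⟩ := h0
    have e1 : slideSource k (a, 0) = (a + 1, 0) := by simp [slideSource, hi]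
    have h1 := (ha a hi).1
    have h2 := (h.col h1).1
    rw [e1]
    simp [h1, h2, hi.ne]
  · by_cases hi : a = k
    · subst hi
      have e1 : slideSource a (a, d) = (a, d + 1) := by simp [slideSource]
      rw [e1]
      constructor
      · intro hz
        by_contra hn
        simp only [Prod.mk.injEq, true_and, not_or] at hn
        have h3 : ¬ d < l := fun hdl => (h.row_le (Nat.succ_le_of_lt hdl) hl).1 hz
        exact (h.row_le (show l + 1 ≤ d by omega) hn.1).1 hl'
      · rintro (hz | hz)
        · by_contra hn
          exact (h.row _ _ hn).1 hz
        · simp only [Prod.mk.injEq, true_and] at hz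
          rwa [hz]
    · have e1 : slideSource k (a, d) = (a, d) := by simp only [slideSource]; grind
      rw [e1]
      simp [hi]

/-! ### Evacuation and its invariant -/

/-- Rounds of evacuation preserve the Richardson condition. If the slide of `F`, on reaching row
`r`, would turn right, then the largest entry of the evacuation in or below row `r` lies in
row `r`. -/
theorem exists_evacRounds_eq (n : ℕ) (F : ℕ × ℕ → ℕ) (h : IsRichardsonFilling n F) :
    ∃ V, IsRichardsonFilling n V ∧ (∀ x, V x = 0 ↔ F x = 0) ∧
      -- All `G` are needed, since each round passes an updated accumulator on.
      (∀ G x, evacRounds n F G x = if F x = 0 then G x else V x) ∧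
      ∀ r, F (r, 0) ≠ 0 → ¬ Descends F r →
        ∃ b, V (r, b) ≠ 0 ∧ ∀ a d, r < a → V (a, d) < V (r, b) := by
  induction n generalizing F with
  | zero =>
    have h0 : ∀ x, F x = 0 := fun x => Nat.le_zero.1 (h.le x)
    exact ⟨F, h, fun _ => Iff.rfl, fun G x => by simp [evacRounds, h0],
      fun r hr => absurd (h0 _) hr⟩
  | succ n ih =>
    obtain ⟨k, l, hl, hl', hk, ha, hs⟩ := h.exists_slide_eq
    have h' := h.slideResult hk ha
    have hz := h.slideResult_eq_zero_iff ha hl hl'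
    obtain ⟨V, hV, hsupp, hev, hmax⟩ := ih _ h'
    set W := Function.update V (k, l) (n + 1) with hW
    have hWk : W (k, l) = n + 1 := by simp [hW]
    have hWne : ∀ x, x ≠ (k, l) → W x = V x := fun x hx => by simp [hW, hx]
    have hVkl : V (k, l) = 0 := (hsupp _).2 ((hz _).2 (Or.inr rfl))
    have hWsupp : ∀ x, W x = 0 ↔ F x = 0 := fun x => by
      by_cases hx : x = (k, l)
      · subst hx; simp [hWk, hl]
      · rw [hWne x hx, hsupp, hz]; simp [hx]
    have hle : ∀ x, V x < n + 1 := fun x => Nat.lt_succ_of_le (hV.le x)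
    refine ⟨W, ⟨?_, ?_, ?_, ?_, ?_⟩, hWsupp, ?_, ?_⟩
    · intro i c hc
      have h1 : (i, c) ≠ (k, l) := fun he => by
        simp only [Prod.mk.injEq] at he
        obtain ⟨rfl, rfl⟩ := he
        exact hc ((hWsupp _).2 hl')
      have h2 : W (i, c) ≠ 0 := fun he =>
        hc ((hWsupp _).2 (by by_contra hn; exact (h.row _ _ hn).1 ((hWsupp _).1 he)))
      refine ⟨h2, ?_⟩
      rw [hWne _ h1]
      by_cases h3 : (i, c + 1) = (k, l)
      · rw [h3, hWk]; exact hle _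
      · rw [hWne _ h3] at hc ⊢
        exact (hV.row _ _ hc).2
    · intro i c hc
      by_cases hx : (i + 1, c) = (k, l)
      · rw [hx, hWk]
        simp only [Prod.mk.injEq] at hx
        obtain ⟨rfl, rfl⟩ := hx
        have hi := ha i (Nat.lt_add_one i)
        have e0 : SemistandardYoungTableau.slideResult (i + 1) F (i, 0) = F (i + 1, 0) - 1 := by
          simp [SemistandardYoungTableau.slideResult]
        have e1 : SemistandardYoungTableau.slideResult (i + 1) F (i, 1) = F (i, 1) - 1 := by
          simp [SemistandardYoungTableau.slideResult]
        have e2 : SemistandardYoungTableau.slideResult (i + 1) F (i + 1, 0) = F (i + 1, 1) - 1 := by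
          simp [SemistandardYoungTableau.slideResult]
        have h0 := h.col hi.1
        -- After the slide, the boxes right of and below `(i, 0)` hold the old entries of column `1`
        -- in rows `i` and `i + 1`, lowered by one. Descending would contradict their order.
        obtain ⟨b, hb, hm⟩ := hmax i (by omega) (by
          rintro ⟨hd, hd'⟩
          rw [e2] at hd hd'
          rw [e1] at hd'
          have hd1 : F (i + 1, 0 + 1) ≠ 0 := fun hz => by simp at hz; omega
          obtain ⟨b, hb, hlt, hm⟩ := h.rich i 1 hd1
          have h4 := hm _ 0 (Nat.lt_add_one i) (h.row _ _ hd1).2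
          have h5 := h.lt_of_row_lt h0.1 (h0.2.trans h4)
          have h6 := h.row_le (c := 1) h5 hb
          have h7 : F (i, 0) < F (i, 1) := (h.row i 0 h6.1).2
          omega)
        have hbk : W (i, b) = V (i, b) := hWne _ (by simp)
        refine ⟨b, hbk ▸ hb, hbk ▸ hle _, fun a d hia hlt => ?_⟩
        have hne : (a, d) ≠ (i + 1, c) := fun he => by rw [he, hWk] at hlt; omega
        rw [hWne _ hne, hbk]
        exact hm a d hia
      -- At an old box the new entry `n + 1` is too large to enter the condition.
      · rw [hWne _ hx] at hc ⊢
        obtain ⟨b, hb, hlt, hm⟩ := hV.rich i c hc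
        have hbk : W (i, b) = V (i, b) := hWne _ fun he => hb (he ▸ hVkl)
        refine ⟨b, hbk ▸ hb, hbk ▸ hlt, fun a d hia hl2 => ?_⟩
        have hne : (a, d) ≠ (k, l) := fun he => by
          rw [he, hWk] at hl2
          exact absurd (hle (i + 1, c)) (by omega)
        rw [hWne _ hne] at hl2 ⊢
        rw [hbk]
        exact hm a d hia hl2
    · intro x y hxy hx
      by_cases h1 : x = (k, l) <;> by_cases h2 : y = (k, l)
      · rw [h1, h2]
      · rw [h1, hWk, hWne y h2] at hxy
        exact absurd (hle y) (by omega)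
      · rw [h2, hWk, hWne x h1] at hxy
        exact absurd (hle x) (by omega)
      · rw [hWne x h1] at hxy hx
        rw [hWne y h2] at hxy
        exact hV.inj x y hxy hx
    · intro j hj hjn
      rcases hjn.eq_or_lt with rfl | hjn
      · exact ⟨_, hWk⟩
      · obtain ⟨x, hx⟩ := hV.surj j hj (by omega)
        exact ⟨x, by rw [hWne x (fun he => hj (by rw [← hx, he, hVkl])), hx]⟩
    · intro x
      by_cases h1 : x = (k, l)
      · rw [h1, hWk]
      · rw [hWne x h1]; exact (hle x).le
    · intro G x
      simp only [evacRounds, hs]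
      rw [hev]
      by_cases h1 : x = (k, l)
      · subst h1
        simp [(hz (k, l)).2 (Or.inr rfl), hl, hWk]
      · simp [hz, h1, hWne x h1]
    · intro r hr hnd
      rcases lt_trichotomy r k with hrk | rfl | hrk
      · exact absurd (ha r hrk) hnd
      · refine ⟨l, by rw [hWk]; omega, fun a d hra => ?_⟩
        rw [hWk, hWne _ (by simp [hra.ne'])]
        exact hle _
      -- Rows below `k` are only lowered by one, so the next slide would turn at row `r` as well.
      · have e : ∀ a d, k < a → SemistandardYoungTableau.slideResult k F (a, d) = F (a, d) - 1 := by
          intro a d hka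
          simp only [SemistandardYoungTableau.slideResult]
          grind
        have hne : ∀ a d, k < a → (a, d) ≠ (k, l) := fun a d hka => by simp [hka.ne']
        have h1 : ∀ x, F x = 1 → x = (0, 0) := fun x => h.eq_corner
        obtain ⟨b, hb, hm⟩ := hmax r
          (mt (hz _).1 (by simp [hr, hrk.ne'])) (fun hd => hnd (by
            simp only [Descends, e r _ hrk, e (r + 1) _ (hrk.trans (Nat.lt_add_one r))] at hd
            have h2 := h1 (r, 1)
            simp only [Prod.mk.injEq, one_ne_zero, and_false, imp_false] at h2
            simp only [Descends]
            omega))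
        refine ⟨b, ?_, fun a d hra => ?_⟩
        · rw [hWne _ (hne r b hrk)]; exact hb
        · rw [hWne _ (hne r b hrk), hWne _ (hne a d (hrk.trans hra))]
          exact hm a d hra

end IsRichardsonFilling

/-! ### Between tableaux and fillings -/

variable {μ : YoungDiagram}

theorem IsStandard.apply_ne_zero_iff {T : SemistandardYoungTableau μ} (hT : T.IsStandard)
    (i c : ℕ) : T i c ≠ 0 ↔ (i, c) ∈ μ := by
  refine ⟨fun h => by_contra fun hn => h (T.zeros hn), fun h => ?_⟩
  have := (hT.mapsTo (x := (i, c)) (by simpa using h)).1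
  simp only at this
  omega

theorem IsRichardson.isRichardsonFilling {T : SemistandardYoungTableau μ} (hT : T.IsRichardson) :
    IsRichardsonFilling μ.card (fun c => T c.1 c.2) where
  row i c hc := by
    have hc' := (hT.1.apply_ne_zero_iff _ _).1 hc
    have h1 : (i, c) ∈ μ := μ.up_left_mem le_rfl (Nat.le_succ c) hc'
    refine ⟨(hT.1.apply_ne_zero_iff _ _).2 h1,
      lt_of_le_of_ne (T.row_weak (Nat.lt_add_one c) hc') fun he => ?_⟩
    have := hT.1.injOn (x₁ := (i, c)) (by simpa using h1) (x₂ := (i, c + 1)) (by simpa using hc') he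
    simp at this
  rich i c hc := by
    obtain ⟨m, ⟨⟨hlt, b, hb, rfl⟩, -⟩, hm⟩ :=
      hT.2 i c _ ((hT.1.apply_ne_zero_iff _ _).1 hc) rfl
    have hb0 := (hT.1.apply_ne_zero_iff _ _).2 hb
    refine ⟨b, hb0, hlt, fun a d hia hl => ?_⟩
    by_cases had : (a, d) ∈ μ
    · exact hm a d had hia hl
    · simp only [T.zeros had]
      exact Nat.pos_of_ne_zero hb0
  inj x y hxy hx :=
    hT.1.injOn (by simpa using (hT.1.apply_ne_zero_iff _ _).1 hx)
      (by simpa using (hT.1.apply_ne_zero_iff _ _).1 (hxy ▸ hx)) hxy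
  surj j hj hjn := by
    obtain ⟨x, -, hx⟩ := hT.1.surjOn (show j ∈ Set.Icc 1 μ.card from ⟨by omega, hjn⟩)
    exact ⟨x, hx⟩
  le x := by
    by_cases hx : x ∈ μ
    · exact (hT.1.mapsTo (x := x) (by simpa using hx)).2
    · have := T.zeros (i := x.1) (j := x.2) hx
      simp [this]

theorem IsRichardsonFilling.exists_tableau {F : ℕ × ℕ → ℕ} (h : IsRichardsonFilling μ.card F)
    (hμ : ∀ x, F x ≠ 0 ↔ x ∈ μ) :
    ∃ T : SemistandardYoungTableau μ, (∀ i c, T i c = F (i, c)) ∧ T.IsRichardson := by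
  have hcol : ∀ {i₁ i₂ c : ℕ}, i₁ < i₂ → F (i₂, c) ≠ 0 → F (i₁, c) < F (i₂, c) := by
    intro i₁ i₂ c hi hc
    induction i₂, Nat.succ_le_of_lt hi using Nat.le_induction with
    | base => exact (h.col hc).2
    | succ i₂ hle ih =>
      have h1 := h.col hc
      exact (ih hle h1.1).trans h1.2
  refine ⟨⟨fun i c => F (i, c), fun hj hc => (h.row_le hj.le ((hμ _).2 hc)).2,
    fun hi hc => hcol hi ((hμ _).2 hc), fun hn => not_not.1 (mt (hμ _).1 hn)⟩,
    fun _ _ => rfl, ⟨fun x hx => ?_, fun x hx y _ hxy => ?_, fun j hj => ?_⟩, ?_⟩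
  · exact ⟨Nat.pos_of_ne_zero ((hμ x).2 (by simpa using hx)), h.le x⟩
  · exact h.inj x y hxy ((hμ x).2 (by simpa using hx))
  · obtain ⟨x, hx⟩ := h.surj j (by have := hj.1; omega) hj.2
    refine ⟨x, ?_, hx⟩
    simpa using (hμ x).1 (by rw [hx]; have := hj.1; omega)
  · rintro i c j hc rfl
    change ∃ m, IsGreatest {x | x < F (i + 1, c) ∧ ∃ b, (i, b) ∈ μ ∧ F (i, b) = x} m ∧
      ∀ a b : ℕ, (a, b) ∈ μ → i + 1 ≤ a → F (a, b) < F (i + 1, c) → F (a, b) < m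
    obtain ⟨b, hb, hlt, hm⟩ := h.rich i c ((hμ _).2 hc)
    -- The witness from `rich` need not be the greatest admissible entry of its row; the supremum of
    -- this bounded set is, and it only strengthens the bound.
    set S := {x | x < F (i + 1, c) ∧ ∃ b, (i, b) ∈ μ ∧ F (i, b) = x} with hS
    have hbS : F (i, b) ∈ S := ⟨hlt, b, (hμ _).1 hb, rfl⟩
    have hbdd : BddAbove S := ⟨F (i + 1, c), fun x hx => hx.1.le⟩
    exact ⟨sSup S, ⟨Nat.sSup_mem ⟨_, hbS⟩ hbdd, fun x hx => le_csSup hbdd hx⟩,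
      fun a d _ hia hl => (hm a d hia hl).trans_le (le_csSup hbdd hbS)⟩

end SemistandardYoungTableau

theorem mainTheorem6 (μ : YoungDiagram) (T : SemistandardYoungTableau μ) (hT : T.IsRichardson) :
    ∃ T' : SemistandardYoungTableau μ, (∀ i j : ℕ, T' i j = T.evac i j) ∧ T'.IsRichardson := by
  obtain ⟨V, hV, hsupp, hev, -⟩ :=
    SemistandardYoungTableau.IsRichardsonFilling.exists_evacRounds_eq _ _ hT.isRichardsonFilling
  obtain ⟨T', hT', hR⟩ := hV.exists_tableau fun x =>
    (not_congr (hsupp x)).trans (hT.1.apply_ne_zero_iff x.1 x.2)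
  refine ⟨T', fun i j => ?_, hR⟩
  rw [hT', SemistandardYoungTableau.evac, hev]
  split_ifs with h0
  · exact (hsupp _).2 h0
  · rfl
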